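/- Let $n\ge 0$, $f:\{0,1\}^n\times\{0,1\}^n\to\{0,1\}$, and let $S$ be a finite set of possible secrets with at least two elements (for instance $S=\{0,1\}^k$, $k\ge 1$). A conditional disclosure of secrets (CDS) protocol consists of a finite set $R$ with a probability distribution on it, from which a string $r$ shared by Alice and Bob is drawn, finite message sets $M_0,M_1$, and message functions: on inputs $x,y\in\{0,1\}^n$ and secret $s\in S$, Alice sends $m_0(x,s,r)\in M_0$ and Bob sends $m_1(y,r)\in M_1$ to a referee. Let $P_{M|xys}$ be the resulting distribution of $M=(m_0,m_1)$. The protocol is * $\epsilon$-correct for $f$ if there is a decoding function $D$ such that $\Pr_r[D(m_0,x,m_1,y)=s]\ge 1-\epsilon$ for all $s\in S$ and all $(x,y)$ with $f(x,y)=1$; * $\delta$-secure for $f$ if there are distributions $Sim_{M|xy}$ on $M_0\times M_1$ such that $\|Sim_{M|xy}-P_{M|xys}\|_1\le\delta$ for all $s\in S$ and all $(x,y)$ with $f(x,y)=0$, where $\|\cdot\|_1$ is the (unnormalised) $\ell^1$ norm. It uses $\log_2|R|$ bits of randomness. Let $pp\overline{CDS}_{S,\epsilon}(f)$ be the infimum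 of the number of bits of randomness over all protocols that are $\epsilon$-correct and perfectly private ($0$-secure) for $f$, and $pc\overline{CDS}_{S,\delta}(f)$ the infimum over all protocols that are perfectly correct ($0$-correct) and $\delta$-secure for $f$. For a Boolean function $h$ on $\{0,1\}^n\times\{0,1\}^n$ write $g|_h$ for a real $2^n\times 2^n$ matrix $g$ with $g(x,y)=0\Leftrightarrow h(x,y)=0$. Then (with the convention $\log_2 0=0$, which only concerns the zero matrix): 1. for every $0\le\epsilon<1-1/|S|$ there is a matrix $g|_f$ such that $$pp\overline{CDS}_{S,\epsilon}(f)\ \ge\ \tfrac14\log_2\operatorname{rank}\, g|_f ;$$ 2. for every $0\le\delta<2(1-1/|S|)$ there is a matrix $g|_{\neg f}$ such that $$pc\overline{CDS}_{S,\delta}(f)\ \ge\ \tfrac14\log_2\operatorname{rank}\, g|_{\neg f}.$$ -/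

import Mathlib

/-- A conditional disclosure of secrets (CDS) protocol with inputs `x, y ∈ {0,1}ⁿ` and secrets in
`S`. Alice and Bob share a random `r ∈ R` with law `law`; Alice sends `msgA x s r` and Bob sends
`msgB y r` to a referee. -/
structure CDSProtocol (n : ℕ) (S : Type) where
  /-- the values of the shared random string -/
  R : Type
  /-- Alice's messages -/
  M₀ : Type
  /-- Bob's messages -/
  M₁ : Type
  [fintypeR : Fintype R]
  [fintypeM₀ : Fintype M₀]
  [fintypeM₁ : Fintype M₁]
  law : PMF R
  msgA : (Fin n → Bool) → S → R → M₀
  msgB : (Fin n → Bool) → R → M₁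

namespace CDSProtocol

attribute [instance] fintypeR fintypeM₀ fintypeM₁

variable {n : ℕ} {S : Type}

/-- The law of the pair of messages on inputs `x, y` and secret `s`. -/
noncomputable def msgLaw (P : CDSProtocol n S) (x y : Fin n → Bool) (s : S) :
    PMF (P.M₀ × P.M₁) :=
  P.law.map fun r => (P.msgA x s r, P.msgB y r)

/-- `ε`-correctness: the referee, who knows `x`, `y` and both messages, outputs the secret with
probability at least `1 - ε` over `r`, for every secret and all `(x, y)` with `f x y = 1`. -/
def IsCorrect (P : CDSProtocol n S) (f : (Fin n → Bool) → (Fin n → Bool) → Bool) (ε : ℝ) : Prop :=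
  ∃ D : P.M₀ → (Fin n → Bool) → P.M₁ → (Fin n → Bool) → S,
    ∀ (s : S) (x y : Fin n → Bool), f x y = true →
      1 - ε ≤ ((P.law.map fun r => D (P.msgA x s r) x (P.msgB y r) y) s).toReal

/-- `δ`-security: the messages can be simulated from `x, y` alone, up to `δ` in (unnormalised)
`ℓ¹` distance, for every secret and all `(x, y)` with `f x y = 0`. -/
def IsSecure (P : CDSProtocol n S) (f : (Fin n → Bool) → (Fin n → Bool) → Bool) (δ : ℝ) : Prop :=
  ∃ Sim : (Fin n → Bool) → (Fin n → Bool) → PMF (P.M₀ × P.M₁),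
    ∀ (s : S) (x y : Fin n → Bool), f x y = false →
      ∑ m, |(Sim x y m).toReal - (P.msgLaw x y s m).toReal| ≤ δ

/-- The number of bits of shared randomness, `log₂ |R|`. -/
noncomputable def randomBits (P : CDSProtocol n S) : ℝ :=
  Real.logb 2 (Fintype.card P.R)

end CDSProtocol

/-- Randomness complexity of perfectly private, `ε`-correct CDS for `f` with secrets in `S`. -/
noncomputable def ppCDSRandomness {n : ℕ} (S : Type)
    (f : (Fin n → Bool) → (Fin n → Bool) → Bool) (ε : ℝ) : EReal :=
  ⨅ (P : CDSProtocol n S) (_ : P.IsCorrect f ε ∧ P.IsSecure f 0), (P.randomBits : EReal)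

/-- Randomness complexity of perfectly correct, `δ`-secure CDS for `f` with secrets in `S`. -/
noncomputable def pcCDSRandomness {n : ℕ} (S : Type)
    (f : (Fin n → Bool) → (Fin n → Bool) → Bool) (δ : ℝ) : EReal :=
  ⨅ (P : CDSProtocol n S) (_ : P.IsCorrect f 0 ∧ P.IsSecure f δ), (P.randomBits : EReal)

/-- `g` is a real matrix of type `g|_f`: it vanishes exactly where `f` does. -/
def HasZerosOf {n : ℕ} (g : Matrix (Fin n → Bool) (Fin n → Bool) ℝ)
    (f : (Fin n → Bool) → (Fin n → Bool) → Bool) : Prop :=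
  ∀ x y, g x y = 0 ↔ f x y = false

/-! For a fixed protocol, the inner product of the message laws of secrets `s` and `t` is the
probability that two independent runs, with strings `r` and `r'`, produce the same messages.
Collision splits into an event for Alice, depending on `x`, and one for Bob, depending on `y`. So
every combination `overlap w` of these inner products factors through `R × R` and has rank at most
`|R| ^ 2` (`rank_overlap_le`). It remains to choose `w` so that the zeros are right. For perfect
privacy, the sum of squared distances between the laws vanishes exactly when they all coincide. For
perfect correctness, the sum of the off-diagonal inner products vanishes exactly when the laws have
disjoint supports. -/

open Classical in
lemma PMF.toReal_map_apply {α β : Type*} [Fintype α] (p : PMF α) (f : α → β) (b : β) :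
    (p.map f b).toReal = ∑ a, if f a = b then (p a).toReal else 0 := by
  rw [PMF.map_apply, tsum_fintype, ENNReal.toReal_sum]
  · refine Finset.sum_congr rfl fun a _ => ?_
    by_cases h : f a = b
    · simp [h]
    · simp [h, Ne.symm h]
  · intro a _
    split_ifs
    · exact p.apply_ne_top a
    · exact ENNReal.zero_ne_top

lemma PMF.sum_toReal_eq_one {α : Type*} [Fintype α] (p : PMF α) : ∑ a, (p a).toReal = 1 := by
  have h := p.tsum_coe
  rw [tsum_fintype] at h
  rw [← ENNReal.toReal_sum fun a _ => p.apply_ne_top a, h, ENNReal.toReal_one]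

/-- The disagreement `∑ₛₜ ‖vₛ - vₜ‖²` of a family of vectors is a combination of their inner
products. -/
lemma sum_sum_sub_sq {S M : Type*} [Fintype S] [DecidableEq S] [Fintype M] (v : S → M → ℝ) :
    ∑ s, ∑ t, (if s = t then 2 * (Fintype.card S : ℝ) - 2 else -2) * ∑ m, v s m * v t m =
      ∑ s, ∑ t, ∑ m, (v s m - v t m) ^ 2 := by
  -- Each squared norm occurs `2 * |S|` times in the double sum; the `-2` is the cross term, present
  -- on the diagonal too.
  have h₁ : ∀ s t, (if s = t then 2 * (Fintype.card S : ℝ) - 2 else -2) * ∑ m, v s m * v t m =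
      (if s = t then 2 * (Fintype.card S : ℝ) * ∑ m, v s m * v t m else 0) -
        2 * ∑ m, v s m * v t m := by
    intro s t
    split_ifs <;> ring
  have h₂ : ∀ s t, ∑ m, (v s m - v t m) ^ 2 =
      ∑ m, v s m * v s m + ∑ m, v t m * v t m - 2 * ∑ m, v s m * v t m := by
    intro s t
    rw [Finset.mul_sum, ← Finset.sum_add_distrib, ← Finset.sum_sub_distrib]
    exact Finset.sum_congr rfl fun m _ => by ring
  simp only [h₁, h₂, Finset.sum_sub_distrib, Finset.sum_add_distrib, Finset.sum_ite_eq,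
    Finset.mem_univ, if_true, Finset.sum_const, Finset.card_univ, nsmul_eq_mul, ← Finset.mul_sum]
  ring

/-- A law whose supports separate the members of a family of laws is at `ℓ¹` distance at least
`2 (1 - 1/|S|)` from one of them. -/
lemma exists_le_l1_of_disjoint {S M : Type*} [Fintype S] [Nonempty S] [Fintype M]
    (p : S → PMF M) (q : PMF M)
    (h : ∀ s t, s ≠ t → ∀ m, (p s m).toReal * (p t m).toReal = 0) :
    ∃ s, 2 * (1 - 1 / (Fintype.card S : ℝ)) ≤ ∑ m, |(q m).toReal - (p s m).toReal| := by
  classical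
  by_contra! hlt
  have hcard : (0 : ℝ) < Fintype.card S := by exact_mod_cast Fintype.card_pos
  have hmin : ∀ s, ∑ m, |(q m).toReal - (p s m).toReal| =
      2 - 2 * ∑ m, min (q m).toReal (p s m).toReal := by
    intro s
    have : ∀ m, |(q m).toReal - (p s m).toReal| =
        (q m).toReal + (p s m).toReal - 2 * min (q m).toReal (p s m).toReal := by
      intro m
      rcases le_total (q m).toReal (p s m).toReal with hm | hm
      · rw [min_eq_left hm, abs_of_nonpos (by linarith)]; ring
      · rw [min_eq_right hm, abs_of_nonneg (by linarith)]; ring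
    simp only [this, Finset.sum_sub_distrib, Finset.sum_add_distrib, PMF.sum_toReal_eq_one,
      ← Finset.mul_sum]
    ring
  -- By disjointness at most one law charges `m`, so at most one minimum is nonzero.
  have hpt : ∀ m, ∑ s, min (q m).toReal (p s m).toReal ≤ (q m).toReal := by
    intro m
    by_cases hz : ∀ s, (p s m).toReal = 0
    · simp [hz]
    · push Not at hz
      obtain ⟨s, hs⟩ := hz
      rw [Finset.sum_eq_single s]
      · exact min_le_left _ _
      · intro t _ hts
        rw [(mul_eq_zero.mp (h t s hts m)).resolve_right hs]
        exact min_eq_right ENNReal.toReal_nonneg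
      · simp
  have hle : ∑ s, ∑ m, min (q m).toReal (p s m).toReal ≤ 1 := by
    rw [Finset.sum_comm, ← PMF.sum_toReal_eq_one q]
    exact Finset.sum_le_sum fun m _ => hpt m
  have hgt : ∑ _s : S, 1 / (Fintype.card S : ℝ) <
      ∑ s, ∑ m, min (q m).toReal (p s m).toReal := by
    refine Finset.sum_lt_sum_of_nonempty Finset.univ_nonempty fun s _ => ?_
    have := hlt s
    rw [hmin s] at this
    linarith
  rw [Finset.sum_const, Finset.card_univ, nsmul_eq_mul, mul_one_div_cancel hcard.ne'] at hgt
  linarith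

namespace CDSProtocol

variable {n : ℕ} {S : Type}

/-- The combination, with coefficients `w`, of the inner products of the message laws. -/
noncomputable def overlap [Fintype S] (P : CDSProtocol n S) (w : S → S → ℝ) :
    Matrix (Fin n → Bool) (Fin n → Bool) ℝ :=
  Matrix.of fun x y =>
    ∑ s, ∑ t, w s t * ∑ m, (P.msgLaw x y s m).toReal * (P.msgLaw x y t m).toReal

-- Expanding both laws over independent strings separates the dependence on `x` from that on `y`.
open Classical in
lemma sum_msgLaw_mul_msgLaw (P : CDSProtocol n S) (x y : Fin n → Bool) (s t : S) :
    ∑ m, (P.msgLaw x y s m).toReal * (P.msgLaw x y t m).toReal =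
      ∑ r : P.R × P.R, (if P.msgA x s r.1 = P.msgA x t r.2 then
        (P.law r.1).toReal * (P.law r.2).toReal else 0) *
          (if P.msgB y r.1 = P.msgB y r.2 then 1 else 0) := by
  have hmul : ∀ a b : P.R → ℝ,
      (∑ r, a r) * ∑ r, b r = ∑ r : P.R × P.R, a r.1 * b r.2 := fun a b => by
    rw [Fintype.sum_mul_sum, Fintype.sum_prod_type]
  simp only [msgLaw, PMF.toReal_map_apply, hmul]
  rw [Finset.sum_comm]
  refine Finset.sum_congr rfl fun r _ => ?_
  rw [Finset.sum_eq_single (P.msgA x s r.1, P.msgB y r.1)]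
  · by_cases h₀ : P.msgA x s r.1 = P.msgA x t r.2 <;>
      by_cases h₁ : P.msgB y r.1 = P.msgB y r.2 <;>
      simp [h₀, h₁, eq_comm]
  · intro m _ hm
    rw [if_neg hm.symm, zero_mul]
  · simp

lemma rank_overlap_le [Fintype S] (P : CDSProtocol n S) (w : S → S → ℝ) :
    (P.overlap w).rank ≤ Fintype.card P.R ^ 2 := by
  classical
  have hfac : P.overlap w =
      (Matrix.of fun (x : Fin n → Bool) (r : P.R × P.R) => ∑ s, ∑ t, w s t *
        if P.msgA x s r.1 = P.msgA x t r.2 then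
          (P.law r.1).toReal * (P.law r.2).toReal else 0) *
      (Matrix.of fun (r : P.R × P.R) (y : Fin n → Bool) =>
        if P.msgB y r.1 = P.msgB y r.2 then (1 : ℝ) else 0) := by
    ext x y
    simp only [overlap, Matrix.mul_apply, Matrix.of_apply, sum_msgLaw_mul_msgLaw,
      Finset.mul_sum, Finset.sum_mul]
    rw [Finset.sum_comm (s := (Finset.univ : Finset (P.R × P.R)))]
    refine Finset.sum_congr rfl fun s _ => ?_
    rw [Finset.sum_comm]
    simp only [mul_assoc]
  rw [hfac]
  refine (Matrix.rank_mul_le_left _ _).trans ((Matrix.rank_le_card_width _).trans ?_)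
  rw [Fintype.card_prod, sq]

/-- The bound on `k` even gives the factor `1 / 2`; nonnegativity of `randomBits` weakens it to `1 /
4`. -/
lemma quarter_logb_rank_le_randomBits (P : CDSProtocol n S) {k : ℕ}
    (hk : k ≤ Fintype.card P.R ^ 2) : 1 / 4 * Real.logb 2 k ≤ P.randomBits := by
  obtain ⟨r, -⟩ := P.law.support_nonempty
  have : Nonempty P.R := ⟨r⟩
  have hR : (1 : ℝ) ≤ Fintype.card P.R := by exact_mod_cast Fintype.card_pos (α := P.R)
  have hbits : 0 ≤ P.randomBits := Real.logb_nonneg one_lt_two hR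
  rcases Nat.eq_zero_or_pos k with rfl | hpos
  · simpa using hbits
  · have hk' : (k : ℝ) ≤ (Fintype.card P.R : ℝ) ^ 2 := by exact_mod_cast hk
    have := Real.logb_le_logb_of_le one_lt_two (by exact_mod_cast hpos) hk'
    rw [Real.logb_pow] at this
    push_cast at this
    change Real.logb 2 k ≤ 2 * P.randomBits at this
    linarith

lemma overlap_eq_sum_sub_sq [Fintype S] [DecidableEq S] (P : CDSProtocol n S)
    (x y : Fin n → Bool) :
    P.overlap (fun s t => if s = t then 2 * (Fintype.card S : ℝ) - 2 else -2) x y =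
      ∑ s, ∑ t, ∑ m, ((P.msgLaw x y s m).toReal - (P.msgLaw x y t m).toReal) ^ 2 :=
  sum_sum_sub_sq fun s m => (P.msgLaw x y s m).toReal

lemma map_decode_eq (P : CDSProtocol n S)
    (D : P.M₀ → (Fin n → Bool) → P.M₁ → (Fin n → Bool) → S) (x y : Fin n → Bool) (s : S) :
    (P.law.map fun r => D (P.msgA x s r) x (P.msgB y r) y) =
      (P.msgLaw x y s).map fun m => D m.1 x m.2 y := by
  rw [msgLaw, PMF.map_comp]
  rfl

/-- Secrets that can be guessed better than at random give rise to different message laws. -/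
lemma IsCorrect.exists_msgLaw_ne [Fintype S] [Nonempty S] {P : CDSProtocol n S}
    {f : (Fin n → Bool) → (Fin n → Bool) → Bool} {ε : ℝ} (hP : P.IsCorrect f ε)
    (hε : ε < 1 - 1 / (Fintype.card S : ℝ)) {x y : Fin n → Bool} (hxy : f x y = true) :
    ∃ s t m, (P.msgLaw x y s m).toReal ≠ (P.msgLaw x y t m).toReal := by
  obtain ⟨D, hD⟩ := hP
  by_contra! h
  have hcard : (0 : ℝ) < Fintype.card S := by exact_mod_cast Fintype.card_pos
  obtain ⟨s₀⟩ := ‹Nonempty S›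
  have hlaw : ∀ s, P.msgLaw x y s = P.msgLaw x y s₀ := fun s => PMF.ext fun m =>
    (ENNReal.toReal_eq_toReal_iff' (PMF.apply_ne_top _ _) (PMF.apply_ne_top _ _)).mp (h s s₀ m)
  -- With a common law the decoder's output does not depend on the secret, so its success
  -- probabilities sum to at most 1.
  have hsum : ∑ _s : S, (1 - ε) ≤ 1 := by
    refine le_of_le_of_eq ?_
      (PMF.sum_toReal_eq_one ((P.msgLaw x y s₀).map fun m => D m.1 x m.2 y))
    refine Finset.sum_le_sum fun s _ => ?_
    have := hD s x y hxy
    rwa [map_decode_eq, hlaw] at this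
  rw [Finset.sum_const, Finset.card_univ, nsmul_eq_mul] at hsum
  have : 1 / (Fintype.card S : ℝ) * Fintype.card S < (1 - ε) * Fintype.card S :=
    mul_lt_mul_of_pos_right (by linarith) hcard
  rw [one_div_mul_cancel hcard.ne'] at this
  linarith

lemma IsSecure.msgLaw_eq {P : CDSProtocol n S}
    {f : (Fin n → Bool) → (Fin n → Bool) → Bool} (hP : P.IsSecure f 0) {x y : Fin n → Bool}
    (hxy : f x y = false) (s t : S) (m : P.M₀ × P.M₁) :
    (P.msgLaw x y s m).toReal = (P.msgLaw x y t m).toReal := by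
  obtain ⟨Sim, hSim⟩ := hP
  have key : ∀ u, (Sim x y m).toReal = (P.msgLaw x y u m).toReal := fun u =>
    sub_eq_zero.mp <| abs_nonpos_iff.mp <|
      (Finset.single_le_sum (f := fun m => |(Sim x y m).toReal - (P.msgLaw x y u m).toReal|)
        (fun _ _ => abs_nonneg _) (Finset.mem_univ m)).trans (hSim u x y hxy)
  rw [← key s, ← key t]

/-- Perfect correctness makes the message laws of different secrets disjoint. -/
lemma IsCorrect.msgLaw_mul_msgLaw_eq_zero {P : CDSProtocol n S}
    {f : (Fin n → Bool) → (Fin n → Bool) → Bool} (hP : P.IsCorrect f 0) {x y : Fin n → Bool}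
    (hxy : f x y = true) {s t : S} (hst : s ≠ t) (m : P.M₀ × P.M₁) :
    (P.msgLaw x y s m).toReal * (P.msgLaw x y t m).toReal = 0 := by
  classical
  obtain ⟨D, hD⟩ := hP
  have key : ∀ u, D m.1 x m.2 y ≠ u → (P.msgLaw x y u m).toReal = 0 := by
    intro u hu
    have h := hD u x y hxy
    -- With 1 written as the total mass, `h` says that the messages decoded wrongly have mass at
    -- most 0.
    rw [map_decode_eq, PMF.toReal_map_apply, sub_zero,
      ← PMF.sum_toReal_eq_one (P.msgLaw x y u), ← sub_nonpos, ← Finset.sum_sub_distrib] at h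
    have hnonneg : ∀ m' ∈ Finset.univ, 0 ≤ (P.msgLaw x y u m').toReal -
        (if D m'.1 x m'.2 y = u then (P.msgLaw x y u m').toReal else 0) := by
      intro m' _
      split_ifs
      · simp
      · simp
    have := (Finset.single_le_sum hnonneg (Finset.mem_univ m)).trans h
    rw [if_neg hu, sub_zero] at this
    exact le_antisymm this ENNReal.toReal_nonneg
  by_cases hs : D m.1 x m.2 y = s
  · rw [key t (hs ▸ hst), mul_zero]
  · rw [key s hs, zero_mul]

lemma hasZerosOf_of_perfectly_private [Fintype S] [Nonempty S] [DecidableEq S]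
    {P : CDSProtocol n S} {f : (Fin n → Bool) → (Fin n → Bool) → Bool} {ε : ℝ}
    (hε : ε < 1 - 1 / (Fintype.card S : ℝ)) (hc : P.IsCorrect f ε) (hs : P.IsSecure f 0) :
    HasZerosOf (P.overlap fun s t => if s = t then 2 * (Fintype.card S : ℝ) - 2 else -2) f := by
  intro x y
  rw [overlap_eq_sum_sub_sq]
  constructor
  · intro h
    by_contra hxy
    obtain ⟨s, t, m, hne⟩ := hc.exists_msgLaw_ne hε (Bool.not_eq_false _ ▸ hxy)
    rw [Finset.sum_eq_zero_iff_of_nonneg fun _ _ => by positivity] at h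
    have h₁ := h s (Finset.mem_univ s)
    rw [Finset.sum_eq_zero_iff_of_nonneg fun _ _ => by positivity] at h₁
    have h₂ := h₁ t (Finset.mem_univ t)
    rw [Finset.sum_eq_zero_iff_of_nonneg fun _ _ => by positivity] at h₂
    exact hne (sub_eq_zero.mp (pow_eq_zero_iff two_ne_zero |>.mp (h₂ m (Finset.mem_univ m))))
  · intro hxy
    exact Finset.sum_eq_zero fun s _ => Finset.sum_eq_zero fun t _ => Finset.sum_eq_zero
      fun m _ => by rw [hs.msgLaw_eq hxy s t m, sub_self, zero_pow two_ne_zero]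

/-- Where `f` is 0, disjoint laws would leave any simulator too far from one of them. -/
lemma hasZerosOf_of_perfectly_correct [Fintype S] [Nonempty S] [DecidableEq S]
    {P : CDSProtocol n S} {f : (Fin n → Bool) → (Fin n → Bool) → Bool} {δ : ℝ}
    (hδ : δ < 2 * (1 - 1 / (Fintype.card S : ℝ))) (hc : P.IsCorrect f 0) (hs : P.IsSecure f δ) :
    HasZerosOf (P.overlap fun s t => if s = t then 0 else 1) fun x y => !f x y := by
  intro x y
  simp only [overlap, Matrix.of_apply, Bool.not_eq_false']
  have hm : ∀ s t, ∀ m ∈ Finset.univ,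
      0 ≤ (P.msgLaw x y s m).toReal * (P.msgLaw x y t m).toReal := fun _ _ _ _ => by positivity
  have ht : ∀ s, ∀ t ∈ Finset.univ, 0 ≤ (if s = t then (0 : ℝ) else 1) *
      ∑ m, (P.msgLaw x y s m).toReal * (P.msgLaw x y t m).toReal := fun s t _ =>
    mul_nonneg (by split_ifs <;> norm_num) (Finset.sum_nonneg (hm s t))
  constructor
  · intro h
    by_contra hxy
    obtain ⟨Sim, hSim⟩ := hs
    obtain ⟨s, hle⟩ := exists_le_l1_of_disjoint (P.msgLaw x y) (Sim x y) (by
      intro s t hst m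
      have h₁ := (Finset.sum_eq_zero_iff_of_nonneg fun s _ => Finset.sum_nonneg (ht s)).mp h
        s (Finset.mem_univ s)
      have h₂ := (Finset.sum_eq_zero_iff_of_nonneg (ht s)).mp h₁ t (Finset.mem_univ t)
      rw [if_neg hst, one_mul] at h₂
      exact (Finset.sum_eq_zero_iff_of_nonneg (hm s t)).mp h₂ m (Finset.mem_univ m))
    have := hSim s x y (Bool.not_eq_true _ ▸ hxy)
    linarith
  · intro hxy
    refine Finset.sum_eq_zero fun s _ => Finset.sum_eq_zero fun t _ => ?_
    split_ifs with hst
    · rw [zero_mul]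
    · rw [one_mul]
      exact Finset.sum_eq_zero fun m _ => hc.msgLaw_mul_msgLaw_eq_zero hxy hst m

end CDSProtocol

/-- Among the matrices vanishing exactly where `f` does, one has the least rank. -/
lemma exists_hasZerosOf_rank_minimal {n : ℕ} (f : (Fin n → Bool) → (Fin n → Bool) → Bool) :
    ∃ g : Matrix (Fin n → Bool) (Fin n → Bool) ℝ, HasZerosOf g f ∧
      ∀ g' : Matrix (Fin n → Bool) (Fin n → Bool) ℝ, HasZerosOf g' f → g.rank ≤ g'.rank := by
  have hne : {g : Matrix (Fin n → Bool) (Fin n → Bool) ℝ | HasZerosOf g f}.Nonempty :=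
    ⟨Matrix.of fun x y => if f x y then 1 else 0, fun x y => by simp⟩
  exact ⟨Function.argminOn Matrix.rank _ hne, Function.argminOn_mem Matrix.rank _ hne,
    fun g' hg' => Function.argminOn_le Matrix.rank _ hg'⟩

theorem mainTheorem4 {n : ℕ} (f : (Fin n → Bool) → (Fin n → Bool) → Bool)
    (S : Type) [Fintype S] [Nontrivial S] :
    (∀ ε : ℝ, 0 ≤ ε → ε < 1 - 1 / (Fintype.card S : ℝ) →
      ∃ g : Matrix (Fin n → Bool) (Fin n → Bool) ℝ, HasZerosOf g f ∧
        ((1 / 4 * Real.logb 2 g.rank : ℝ) : EReal) ≤ ppCDSRandomness S f ε) ∧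
    (∀ δ : ℝ, 0 ≤ δ → δ < 2 * (1 - 1 / (Fintype.card S : ℝ)) →
      ∃ g : Matrix (Fin n → Bool) (Fin n → Bool) ℝ, HasZerosOf g (fun x y => !f x y) ∧
        ((1 / 4 * Real.logb 2 g.rank : ℝ) : EReal) ≤ pcCDSRandomness S f δ) := by
  classical
  constructor
  · intro ε _ hε
    -- One `g` must serve all protocols in the infimum, hence the choice of least rank.
    obtain ⟨g, hg, hmin⟩ := exists_hasZerosOf_rank_minimal f
    refine ⟨g, hg, le_iInf₂ fun P hP => EReal.coe_le_coe_iff.mpr ?_⟩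
    exact P.quarter_logb_rank_le_randomBits
      ((hmin _ (CDSProtocol.hasZerosOf_of_perfectly_private hε hP.1 hP.2)).trans
        (P.rank_overlap_le _))
  · intro δ _ hδ
    obtain ⟨g, hg, hmin⟩ := exists_hasZerosOf_rank_minimal fun x y => !f x y
    refine ⟨g, hg, le_iInf₂ fun P hP => EReal.coe_le_coe_iff.mpr ?_⟩
    exact P.quarter_logb_rank_le_randomBits
      ((hmin _ (CDSProtocol.hasZerosOf_of_perfectly_correct hδ hP.1 hP.2)).trans
        (P.rank_overlap_le _))
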